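/- A partition of $[n]=\{1,\dots,n\}$ is non-crossing if there are no $a<b<c<d$ such that $a,c$ lie in one block and $b,d$ lie in a different block. For $n\ge 1$ let $X_n$ be the number of blocks of a non-crossing partition of $[n]$ chosen uniformly at random among all non-crossing partitions of $[n]$. Then $$\mathbb{E}(X_n)=\frac{n+1}{2},\qquad \operatorname{Var}(X_n)=\frac{n^2-1}{4(2n-1)}\sim\frac n8\quad(n\to\infty).$$ Let $$Z_n=\frac{X_n-\mathbb{E}(X_n)}{\sqrt{\operatorname{Var}(X_n)}}\qquad(n\ge 2).$$ Then, as $n\to\infty$, the cumulative distribution function of $Z_n$ converges pointwise to the standard Gaussian distribution function: for every $x\in\mathbb{R}$, $$\mathbb{P}(Z_n\le x)\to\Phi(x)=\frac1{\sqrt{2\pi}}\int_{-\infty}^x e^{-t^2/2}\,dt.$$ -/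

import Mathlib

open MeasureTheory ProbabilityTheory Filter Topology

/-- A partition of a finite linearly ordered set is non-crossing if there are no elements
`a < b < c < d` with `a, c` in one block and `b, d` in a different block. -/
def IsNonCrossing {α : Type*} [LinearOrder α] {s : Finset α} (P : Finpartition s) : Prop :=
  ∀ B ∈ P.parts, ∀ B' ∈ P.parts, B ≠ B' →
    ¬ ∃ a ∈ B, ∃ b ∈ B', ∃ c ∈ B, ∃ d ∈ B', a < b ∧ b < c ∧ c < d

/-- The set `NC(n)` of non-crossing partitions of `[n] = {1, …, n}`. -/
def NC (n : ℕ) : Set (Finpartition (Finset.Icc 1 n)) := {P | IsNonCrossing P}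

/-- Every set of partitions of a finite set is an event. -/
instance finpartitionMeasurableSpace {α : Type*} [DecidableEq α] (s : Finset α) :
    MeasurableSpace (Finpartition s) := ⊤

instance finpartitionMeasurableSingletonClass {α : Type*} [DecidableEq α] (s : Finset α) :
    MeasurableSingletonClass (Finpartition s) := ⟨fun _ => trivial⟩

theorem NC_nonempty (n : ℕ) : (NC n).Nonempty := by
  refine ⟨⊥, ?_⟩
  rintro B hB B' - - ⟨a, ha, b, -, c, hc, d, -, hab, hbc, -⟩
  obtain ⟨x, -, rfl⟩ := Finpartition.mem_bot_iff.1 hB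
  rw [Finset.mem_singleton] at ha hc
  omega

/-- The law of a uniformly random non-crossing partition of `[n]`. -/
noncomputable def uniformNC (n : ℕ) : Measure (Finpartition (Finset.Icc 1 n)) :=
  uniformOn (NC n)

instance uniformNC_isProbabilityMeasure (n : ℕ) : IsProbabilityMeasure (uniformNC n) :=
  isProbabilityMeasure_uniformOn (Set.toFinite _) (NC_nonempty n)

/-- The number `X_n` of blocks, as a real random variable. -/
def numBlocks (n : ℕ) (P : Finpartition (Finset.Icc 1 n)) : ℝ := (P.parts.card : ℝ)

/-- The standardized number of blocks `Z_n = (X_n - E X_n) / √(Var X_n)`. -/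
noncomputable def stdNumBlocks (n : ℕ) (P : Finpartition (Finset.Icc 1 n)) : ℝ :=
  (numBlocks n P - ∫ Q, numBlocks n Q ∂(uniformNC n)) /
    Real.sqrt (variance (numBlocks n) (uniformNC n))

/-!
A non-crossing partition of `[n]` is built by adding the elements `1, …, n` in turn. At each time
the blocks that can still receive an element form a stack; a new element either opens a block on
top of the stack, or joins a block of the stack, which closes all blocks above it. Recording the
height of the stack after each step gives a sequence `e` with `e 0 = 0` and
`1 ≤ e (i + 1) ≤ e i + 1`, a height code, and two elements lie in one block exactly when they have
the same height and no element between them has a smaller one. This is a bijection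
(`heightPartition_injOn`, `heightPartition_surjOn`) under which the number of blocks is the number
of ascents (`card_parts_heightPartition`).

Refining the count of codes by the last height gives a linear recursion (`codeCount_succ`), solved
in closed form by `mul_codeCount`. Summation over the last height gives the Narayana numbers
`C(n, l) * C(n, l + 1) / n` for codes with `l` non-ascents
(`mul_card_heightCodes_nonAscents`), so the number of blocks has a hypergeometric law
(`integral_numBlocks`). Mean and variance follow from the symmetry of the weights and Vandermonde's
identity.

For the central limit theorem, the generating polynomial of the weights is a coefficient of a
product of two binomial powers, and extracting it by Fourier inversion shows that the
characteristic function of `2 X_n - (n + 1)` at `s` is the quotient by its value at `s = 0` of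
`∫ ((cos s + cos θ) / 2) ^ n * exp (-iθ) dθ` over `[-π, π]` (`integral_exp_numBlocks`). Under the
scaling `s ~ a / √n`, `θ = φ / √n`, the integrand converges to `exp (-(a² + φ²) / 4)` with a
Gaussian dominating function (`tendsto_sqrt_mul_cosPowIntegral`), so the characteristic functions
of the standardized variables converge to that of the standard Gaussian law. Lévy's continuity
theorem concludes.
-/

/-! ### Partitions of a finset as equivalence relations -/

section Finpartition

variable {α : Type*} [DecidableEq α] {s : Finset α}

theorem Finpartition.parts_eq_image_part (P : Finpartition s) : P.parts = s.image P.part := by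
  ext B
  rw [Finset.mem_image]
  constructor
  · intro hB
    obtain ⟨a, ha, h⟩ := P.part_surjOn hB
    exact ⟨a, ha, h⟩
  · rintro ⟨a, ha, rfl⟩
    exact P.part_mem.2 ha

theorem Finpartition.eq_of_part_eq_iff {P Q : Finpartition s}
    (h : ∀ a ∈ s, ∀ b ∈ s, P.part a = P.part b ↔ Q.part a = Q.part b) : P = Q := by
  have key : ∀ a ∈ s, P.part a = Q.part a := by
    intro a ha
    ext b
    by_cases hb : b ∈ s
    · rw [P.mem_part_iff_part_eq_part hb ha, Q.mem_part_iff_part_eq_part hb ha, h b hb a ha]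
    · exact iff_of_false (fun hh => hb (P.part_subset a hh)) (fun hh => hb (Q.part_subset a hh))
  ext1
  rw [P.parts_eq_image_part, Q.parts_eq_image_part]
  exact Finset.image_congr key

/-- Non-crossing as a property of the equivalence relation `P.part a = P.part b`. -/
theorem isNonCrossing_iff_part {α : Type*} [LinearOrder α] {s : Finset α} {P : Finpartition s} :
    IsNonCrossing P ↔ ∀ a ∈ s, ∀ b ∈ s, ∀ c ∈ s, ∀ d ∈ s, a < b → b < c → c < d →
      P.part a = P.part c → P.part b = P.part d → P.part a = P.part b := by
  constructor
  · intro h a ha b hb c hc d hd hab hbc hcd hac hbd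
    by_contra hne
    exact h _ (P.part_mem.2 ha) _ (P.part_mem.2 hb) hne ⟨a, P.mem_part ha, b, P.mem_part hb, c,
      hac ▸ P.mem_part hc, d, hbd ▸ P.mem_part hd, hab, hbc, hcd⟩
  · rintro h B hB B' hB' hne ⟨a, ha, b, hb, c, hc, d, hd, hab, hbc, hcd⟩
    have e1 := P.part_eq_of_mem hB ha
    have e2 := P.part_eq_of_mem hB hc
    have e3 := P.part_eq_of_mem hB' hb
    have e4 := P.part_eq_of_mem hB' hd
    apply hne
    rw [← e1, ← e3]
    exact h a (P.le hB ha) b (P.le hB' hb) c (P.le hB hc) d (P.le hB' hd) hab hbc hcd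
      (e1.trans e2.symm) (e3.trans e4.symm)

end Finpartition

/-! ### Height codes of non-crossing partitions -/

open Classical in
/-- The height codes of length `n`: sequences `e` with `e 0 = 0` and `1 ≤ e (i + 1) ≤ e i + 1` for
`i < n`, extended by zero beyond `n` so that distinct codes are distinct functions. -/
noncomputable def heightCodes : ℕ → Finset (ℕ → ℕ)
  | 0 => {0}
  | n + 1 => (heightCodes n).biUnion fun e =>
      (Finset.Icc 1 (e n + 1)).image (Function.update e (n + 1))

theorem mem_heightCodes {n : ℕ} {e : ℕ → ℕ} :
    e ∈ heightCodes n ↔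
      e 0 = 0 ∧ (∀ i < n, 1 ≤ e (i + 1) ∧ e (i + 1) ≤ e i + 1) ∧ ∀ i, n < i → e i = 0 := by
  induction n generalizing e with
  | zero =>
    simp only [heightCodes, Finset.mem_singleton]
    constructor
    · rintro rfl
      simp
    · rintro ⟨h0, -, h⟩
      ext i
      rcases Nat.eq_zero_or_pos i with rfl | hi
      · exact h0
      · exact h i hi
  | succ n ih =>
    simp only [heightCodes, Finset.mem_biUnion, Finset.mem_image, Finset.mem_Icc]
    constructor
    · rintro ⟨e', he', m, ⟨hm1, hm2⟩, rfl⟩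
      obtain ⟨h0, h1, h2⟩ := ih.1 he'
      refine ⟨by simp [h0], fun i hi => ?_, fun i hi => ?_⟩
      · rcases Nat.lt_succ_iff_lt_or_eq.1 hi with hi | rfl
        · have a1 : i + 1 ≠ n + 1 := by omega
          have a2 : i ≠ n + 1 := by omega
          simpa [Function.update_apply, a2, hi.ne] using h1 i hi
        · simp [hm1, hm2]
      · have a2 : i ≠ n + 1 := by omega
        simpa [Function.update_apply, a2] using h2 i (by omega)
    · rintro ⟨h0, h1, h2⟩
      refine ⟨Function.update e (n + 1) 0, ih.2 ⟨?_, fun i hi => ?_, fun i hi => ?_⟩,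
        e (n + 1), ?_, ?_⟩
      · simp [h0]
      · have a2 : i ≠ n + 1 := by omega
        simpa [Function.update_apply, a2, hi.ne] using h1 i (by omega)
      · rcases eq_or_ne i (n + 1) with rfl | hne
        · simp
        · simpa [Function.update_apply, hne] using h2 i (by omega)
      · simpa [Function.update_apply] using h1 n (by omega)
      · simp

/-- The equivalence relation coded by a sequence of heights: `i` and `j` are related when they
have equal height and the sequence never drops below that height between them. -/
def heightSetoid (e : ℕ → ℕ) : Setoid ℕ where
  r i j := e i = e j ∧ ∀ k, min i j ≤ k → k ≤ max i j → e i ≤ e k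
  iseqv :=
    { refl := fun i => ⟨rfl, fun k h1 h2 => by
        obtain rfl : k = i := by omega
        exact le_rfl⟩
      symm := fun {i j} h => ⟨h.1.symm, fun k h1 h2 => h.1 ▸ h.2 k (by omega) (by omega)⟩
      trans := fun {i j l} h h' => ⟨h.1.trans h'.1, fun k h1 h2 => by
        have e1 := h.1
        by_cases hk : min i j ≤ k ∧ k ≤ max i j
        · exact h.2 k hk.1 hk.2
        · rw [e1]
          exact h'.2 k (by omega) (by omega)⟩ }

theorem heightSetoid_iff_of_le {e : ℕ → ℕ} {i j : ℕ} (h : i ≤ j) :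
    heightSetoid e i j ↔ e i = e j ∧ ∀ k, i ≤ k → k ≤ j → e i ≤ e k := by
  change (e i = e j ∧ ∀ k, min i j ≤ k → k ≤ max i j → e i ≤ e k) ↔ _
  rw [min_eq_left h, max_eq_right h]

open Classical in
/-- The partition of `[n]` whose blocks are the classes of `heightSetoid e`. -/
noncomputable def heightPartition (n : ℕ) (e : ℕ → ℕ) : Finpartition (Finset.Icc 1 n) :=
  Finpartition.ofSetSetoid (heightSetoid e) (Finset.Icc 1 n)

theorem heightPartition_part_eq_iff {n : ℕ} {e : ℕ → ℕ} {i j : ℕ}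
    (hi : i ∈ Finset.Icc 1 n) (hj : j ∈ Finset.Icc 1 n) :
    (heightPartition n e).part i = (heightPartition n e).part j ↔ heightSetoid e i j := by
  classical
  rw [eq_comm, ← Finpartition.mem_part_iff_part_eq_part _ hj hi, heightPartition,
    Finpartition.mem_part_ofSetSetoid_iff_rel]
  simp only [hi, hj, true_and]

theorem heightPartition_mem_NC (n : ℕ) (e : ℕ → ℕ) : heightPartition n e ∈ NC n := by
  refine isNonCrossing_iff_part.2 fun a ha b hb c hc d hd hab hbc hcd hac hbd => ?_
  rw [heightPartition_part_eq_iff ha hc, heightSetoid_iff_of_le (by omega)] at hac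
  rw [heightPartition_part_eq_iff hb hd, heightSetoid_iff_of_le (by omega)] at hbd
  rw [heightPartition_part_eq_iff ha hb, heightSetoid_iff_of_le (by omega)]
  have h1 := hac.2 b (by omega) (by omega)
  have h2 := hbd.2 c (by omega) (by omega)
  exact ⟨by omega, fun k hk1 hk2 => hac.2 k hk1 (by omega)⟩

/-- Discrete intermediate value property: since codes rise by at most one per step, a height `h`
with `1 ≤ h ≤ e (i - 1)` is attained before `i`, and from its last occurrence on, the code stays at
least `h` until `i - 1`. -/
theorem exists_lt_height_eq {n : ℕ} {e : ℕ → ℕ} (he : e ∈ heightCodes n) {i h : ℕ}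
    (hi : i ≤ n) (hi0 : 0 < i) (h1 : 1 ≤ h) (hih : h ≤ e (i - 1)) :
    ∃ k, 1 ≤ k ∧ k < i ∧ e k = h ∧ ∀ l, k ≤ l → l < i → h ≤ e l := by
  obtain ⟨h0, hs, -⟩ := mem_heightCodes.1 he
  let p : ℕ → Prop := fun k => e k ≤ h ∧ k < i
  classical
  have hp0 : p 0 := ⟨by omega, hi0⟩
  have hp := Nat.findGreatest_spec (P := p) hi0.le hp0
  have hmax : ∀ l, Nat.findGreatest p i < l → l < i → h < e l := by
    intro l hl1 hl2
    by_contra hcon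
    exact Nat.findGreatest_is_greatest hl1 hl2.le ⟨not_lt.1 hcon, hl2⟩
  generalize Nat.findGreatest p i = k at hp hmax
  have hk : e k = h := by
    refine le_antisymm hp.1 ?_
    rcases eq_or_ne k (i - 1) with rfl | hne
    · exact hih
    · have hki := hp.2
      have a1 := hmax (k + 1) (by omega) (by omega)
      have a2 := (hs k (by omega)).2
      omega
  refine ⟨k, ?_, hp.2, hk, fun l hl1 hl2 => ?_⟩
  · rcases Nat.eq_zero_or_pos k with rfl | hpos
    · omega
    · exact hpos
  · rcases hl1.eq_or_lt with rfl | hlt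
    · exact hk.ge
    · exact (hmax l hlt hl2).le

/-- The block minima are exactly the ascents of the code. -/
theorem ascent_iff_forall_not_heightSetoid {n : ℕ} {e : ℕ → ℕ} (he : e ∈ heightCodes n) {i : ℕ}
    (hi : i < n) :
    e i < e (i + 1) ↔ ∀ j, 1 ≤ j → j < i + 1 → ¬ heightSetoid e j (i + 1) := by
  obtain ⟨h0, hs, -⟩ := mem_heightCodes.1 he
  constructor
  · intro hlt j hj hji hr
    rw [heightSetoid_iff_of_le hji.le] at hr
    have := hr.2 i (by omega) (by omega)
    omega
  · intro h
    by_contra hcon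
    obtain ⟨k, hk1, hk2, hk3, hk4⟩ := exists_lt_height_eq he (i := i + 1)
      (h := e (i + 1)) (by omega) (by omega) (hs i hi).1 (by simpa using hcon)
    refine h k hk1 hk2 ?_
    rw [heightSetoid_iff_of_le hk2.le]
    refine ⟨hk3, fun l hl1 hl2 => ?_⟩
    rcases hl2.eq_or_lt with rfl | hlt
    · exact hk3.le
    · rw [hk3]
      exact hk4 l hl1 hlt

/-- A code is recovered from its partition step by step: at a block minimum it ascends, and
elsewhere it returns to the height of an earlier element of the block. -/
theorem heightPartition_injOn (n : ℕ) :
    Set.InjOn (heightPartition n) (heightCodes n : Set (ℕ → ℕ)) := by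
  intro e he e' he' heq
  have he := Finset.mem_coe.1 he
  have he' := Finset.mem_coe.1 he'
  obtain ⟨h0, hs, hz⟩ := mem_heightCodes.1 he
  obtain ⟨h0', hs', hz'⟩ := mem_heightCodes.1 he'
  have hrel : ∀ i j, 1 ≤ i → i ≤ n → 1 ≤ j → j ≤ n → (heightSetoid e i j ↔ heightSetoid e' i j) := by
    intro i j hi1 hi2 hj1 hj2
    have hi := Finset.mem_Icc.2 ⟨hi1, hi2⟩
    have hj := Finset.mem_Icc.2 ⟨hj1, hj2⟩
    rw [← heightPartition_part_eq_iff hi hj, heq, heightPartition_part_eq_iff hi hj]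
  ext k
  induction k using Nat.strong_induction_on with
  | _ k ih =>
    rcases Nat.lt_or_ge n k with hk | hk
    · rw [hz k hk, hz' k hk]
    rcases k with _ | i
    · rw [h0, h0']
    by_cases hmin : ∀ j, 1 ≤ j → j < i + 1 → ¬ heightSetoid e j (i + 1)
    · have hmin' : ∀ j, 1 ≤ j → j < i + 1 → ¬ heightSetoid e' j (i + 1) := by
        intro j hj1 hj2
        rw [← hrel j (i + 1) hj1 (by omega) (by omega) hk]
        exact hmin j hj1 hj2
      have a := (ascent_iff_forall_not_heightSetoid he (by omega)).2 hmin
      have a' := (ascent_iff_forall_not_heightSetoid he' (by omega)).2 hmin'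
      have b := (hs i (by omega)).2
      have b' := (hs' i (by omega)).2
      have := ih i (by omega)
      omega
    · push Not at hmin
      obtain ⟨j, hj1, hj2, hj⟩ := hmin
      have hj' := (hrel j (i + 1) hj1 (by omega) (by omega) hk).1 hj
      rw [heightSetoid_iff_of_le hj2.le] at hj hj'
      rw [← hj.1, ← hj'.1, ih j hj2]

theorem heightSetoid_congr {e e' : ℕ → ℕ} {n i j : ℕ} (h : ∀ k ≤ n, e k = e' k) (hi : i ≤ n)
    (hj : j ≤ n) : heightSetoid e i j ↔ heightSetoid e' i j := by
  change (e i = e j ∧ ∀ k, min i j ≤ k → k ≤ max i j → e i ≤ e k) ↔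
    (e' i = e' j ∧ ∀ k, min i j ≤ k → k ≤ max i j → e' i ≤ e' k)
  rw [h i hi, h j hj]
  refine and_congr_right fun _ => forall_congr' fun k => forall_congr' fun h1 =>
    forall_congr' fun h2 => ?_
  rw [h k (by omega)]

/-- Every non-crossing equivalence relation on `[n]` has a height code. The last element `n + 1`
either opens a new block, or joins the block of its predecessor `i` in its block; in the latter
case the heights after `i` stay at least `e i`, since a smaller height would produce a crossing. -/
theorem exists_heightCode (r : Setoid ℕ) (n : ℕ)
    (hr : ∀ a b c d, 1 ≤ a → a < b → b < c → c < d → d ≤ n → r a c → r b d → r a b) :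
    ∃ e ∈ heightCodes n, ∀ i j, 1 ≤ i → i ≤ n → 1 ≤ j → j ≤ n → (r i j ↔ heightSetoid e i j) := by
  induction n with
  | zero => exact ⟨0, by simp [heightCodes], fun i j h1 h2 => by omega⟩
  | succ n ih =>
    obtain ⟨e, he, hre⟩ := ih fun a b c d h1 h2 h3 h4 h5 => hr a b c d h1 h2 h3 h4 (by omega)
    obtain ⟨h0, hs, hz⟩ := mem_heightCodes.1 he
    -- It suffices to find a height for `n + 1` giving the right relations to smaller elements.
    suffices ∃ m, 1 ≤ m ∧ m ≤ e n + 1 ∧ ∀ i, 1 ≤ i → i ≤ n →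
        (r i (n + 1) ↔ heightSetoid (Function.update e (n + 1) m) i (n + 1)) by
      obtain ⟨m, hm1, hm2, hm⟩ := this
      refine ⟨Function.update e (n + 1) m, ?_, ?_⟩
      · simp only [heightCodes, Finset.mem_biUnion, Finset.mem_image, Finset.mem_Icc]
        exact ⟨e, he, m, ⟨hm1, hm2⟩, rfl⟩
      · intro i j hi1 hi2 hj1 hj2
        rcases Nat.lt_or_ge n i with hi | hi <;> rcases Nat.lt_or_ge n j with hj | hj
        · obtain rfl : i = n + 1 := by omega
          obtain rfl : j = n + 1 := by omega
          exact iff_of_true (r.refl' _) (Setoid.refl' _ _)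
        · obtain rfl : i = n + 1 := by omega
          rw [r.comm', hm j hj1 hj, Setoid.comm']
        · obtain rfl : j = n + 1 := by omega
          exact hm i hi1 hi
        · rw [hre i j hi1 hi hj1 hj]
          refine heightSetoid_congr (n := n) (fun k hk => ?_) hi hj
          rw [Function.update_of_ne (by omega)]
    have hupd : ∀ m i, i ≤ n → (heightSetoid (Function.update e (n + 1) m) i (n + 1) ↔
        e i = m ∧ ∀ k, i ≤ k → k ≤ n → e i ≤ e k) := by
      intro m i hi
      rw [heightSetoid_iff_of_le (by omega), Function.update_self,
        Function.update_of_ne (by omega)]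
      refine and_congr_right fun hm => ⟨fun h k hk1 hk2 => ?_, fun h k hk1 hk2 => ?_⟩
      · simpa [Function.update_apply, (show k ≠ n + 1 by omega)] using h k hk1 (by omega)
      · rcases hk2.eq_or_lt with rfl | hlt
        · simp [hm]
        · simpa [Function.update_apply, hlt.ne] using h k hk1 (by omega)
    by_cases hex : ∃ i, 1 ≤ i ∧ i ≤ n ∧ r i (n + 1)
    · classical
      let p : ℕ → Prop := fun i => 1 ≤ i ∧ i ≤ n ∧ r i (n + 1)
      obtain ⟨i, hi1, hi2, hi3, hmax⟩ : ∃ i, 1 ≤ i ∧ i ≤ n ∧ r i (n + 1) ∧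
          ∀ k, i < k → k ≤ n → ¬ r k (n + 1) := by
        obtain ⟨i₀, hi₀⟩ := hex
        have hp := Nat.findGreatest_spec (P := p) hi₀.2.1 hi₀
        refine ⟨_, hp.1, hp.2.1, hp.2.2, fun k hk1 hk2 hk3 => ?_⟩
        exact Nat.findGreatest_is_greatest hk1 hk2 ⟨by omega, hk2, hk3⟩
      have hge : ∀ k, i ≤ k → k ≤ n → e i ≤ e k := by
        intro k hik hkn
        by_contra hlt
        have hk1 : 1 ≤ e k := by
          obtain ⟨k', rfl⟩ : ∃ k', k = k' + 1 := ⟨k - 1, by omega⟩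
          exact (hs k' (by omega)).1
        -- Let `k` be the first index after `i` of height below `e i`, and `a` the last index
        -- before `i` of height `e k`; then `a < i < k < n + 1` is a crossing.
        obtain ⟨k, hk⟩ : ∃ k, (i ≤ k ∧ e k < e i ∧ 1 ≤ e k ∧ k ≤ n) ∧
            ∀ l, l < k → ¬ (i ≤ l ∧ e l < e i ∧ 1 ≤ e l ∧ l ≤ n) := by
          have hE : ∃ k, i ≤ k ∧ e k < e i ∧ 1 ≤ e k ∧ k ≤ n := ⟨k, hik, by omega, hk1, hkn⟩
          exact ⟨Nat.find hE, Nat.find_spec hE, fun l hl => Nat.find_min hE hl⟩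
        obtain ⟨⟨hk1, hk2, hk3, hk4⟩, hkmin⟩ := hk
        have hik : i < k := by
          rcases hk1.eq_or_lt with rfl | h
          · omega
          · exact h
        obtain ⟨a, ha1, ha2, ha3, ha4⟩ := exists_lt_height_eq he (i := i) (h := e k)
          hi2 (by omega) hk3 (by
            obtain ⟨i', rfl⟩ : ∃ i', i = i' + 1 := ⟨i - 1, by omega⟩
            have := (hs i' (by omega)).2
            simp only [Nat.add_sub_cancel]
            omega)
        have hak : r a k := by
          rw [hre a k ha1 (by omega) (by omega) hk4, heightSetoid_iff_of_le (by omega)]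
          refine ⟨ha3, fun l hl1 hl2 => ?_⟩
          rw [ha3]
          rcases Nat.lt_or_ge l i with h | h
          · exact ha4 l hl1 h
          · rcases hl2.eq_or_lt with rfl | hlt
            · exact le_rfl
            · by_contra hcon
              refine hkmin l hlt ⟨h, by omega, ?_, by omega⟩
              obtain ⟨l', rfl⟩ : ∃ l', l = l' + 1 := ⟨l - 1, by omega⟩
              exact (hs l' (by omega)).1
        have hai := hr a i k (n + 1) ha1 ha2 hik (by omega) le_rfl hak hi3
        exact hmax k hik hk4 (r.trans' (r.symm' hak) (r.trans' hai hi3))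
      have hei : 1 ≤ e i := by
        obtain ⟨k', rfl⟩ : ∃ k', i = k' + 1 := ⟨i - 1, by omega⟩
        exact (hs k' (by omega)).1
      refine ⟨e i, hei, (hge n hi2 le_rfl).trans (Nat.le_succ _), fun j hj1 hj2 => ?_⟩
      have hii := (hupd (e i) i hi2).2 ⟨rfl, hge⟩
      have hcong : heightSetoid (Function.update e (n + 1) (e i)) j i ↔ heightSetoid e j i :=
        heightSetoid_congr (n := n) (fun k hk => Function.update_of_ne (by omega) _ _) hj2 hi2
      constructor
      · intro h
        refine Setoid.trans' _ (hcong.2 ?_) hii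
        exact (hre j i hj1 hj2 hi1 hi2).1 (r.trans' h (r.symm' hi3))
      · intro h
        refine r.trans' ((hre j i hj1 hj2 hi1 hi2).2 (hcong.1 ?_)) hi3
        exact Setoid.trans' _ h (Setoid.symm' _ hii)
    · refine ⟨e n + 1, by omega, le_rfl, fun i hi1 hi2 => iff_of_false ?_ ?_⟩
      · exact fun h => hex ⟨i, hi1, hi2, h⟩
      · rw [hupd _ i hi2]
        rintro ⟨h1, h2⟩
        have := h2 n hi2 le_rfl
        omega

theorem heightPartition_surjOn (n : ℕ) :
    Set.SurjOn (heightPartition n) (heightCodes n : Set (ℕ → ℕ)) (NC n) := by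
  intro P hP
  have hP := isNonCrossing_iff_part.1 hP
  obtain ⟨e, he, h⟩ := exists_heightCode (Setoid.ker P.part) n (by
    intro a b c d ha hab hbc hcd hd hac hbd
    refine hP a ?_ b ?_ c ?_ d ?_ hab hbc hcd hac hbd <;> rw [Finset.mem_Icc] <;> omega)
  refine ⟨e, he, Finpartition.eq_of_part_eq_iff fun i hi j hj => ?_⟩
  rw [heightPartition_part_eq_iff hi hj]
  rw [Finset.mem_Icc] at hi hj
  exact (h i j hi.1 hi.2 hj.1 hj.2).symm

/-- The number of steps of a code that are not ascents. -/
def nonAscents (n : ℕ) (e : ℕ → ℕ) : ℕ := ((Finset.range n).filter fun i => e (i + 1) ≤ e i).card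

theorem card_parts_heightPartition {n : ℕ} {e : ℕ → ℕ} (he : e ∈ heightCodes n) :
    (heightPartition n e).parts.card + nonAscents n e = n := by
  classical
  suffices (heightPartition n e).parts.card =
      ((Finset.range n).filter fun i => ¬ e (i + 1) ≤ e i).card by
    rw [this, nonAscents, add_comm, Finset.card_filter_add_card_filter_not, Finset.card_range]
  symm
  refine Finset.card_bij (fun i _ => (heightPartition n e).part (i + 1)) ?_ ?_ ?_
  · intro i hi
    rw [Finset.mem_filter, Finset.mem_range] at hi
    rw [Finpartition.part_mem, Finset.mem_Icc]
    omega
  · have key : ∀ i j, i < n → ¬ e (j + 1) ≤ e j → j < n → i < j →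
        (heightPartition n e).part (i + 1) ≠ (heightPartition n e).part (j + 1) := by
      intro i j hi hj hjn hij h
      rw [heightPartition_part_eq_iff (by rw [Finset.mem_Icc]; omega)
        (by rw [Finset.mem_Icc]; omega)] at h
      exact (ascent_iff_forall_not_heightSetoid he hjn).1 (not_le.1 hj) (i + 1) (by omega)
        (by omega) h
    intro i hi j hj hij
    rw [Finset.mem_filter, Finset.mem_range] at hi hj
    rcases lt_trichotomy i j with h | h | h
    · exact absurd hij (key i j hi.1 hj.2 hj.1 h)
    · exact h
    · exact absurd hij.symm (key j i hj.1 hi.2 hi.1 h)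
  · intro B hB
    obtain ⟨a, ha, rfl⟩ := (heightPartition n e).part_surjOn hB
    have hE : ∃ i, i < n ∧ (heightPartition n e).part (i + 1) = (heightPartition n e).part a := by
      have := Finset.mem_Icc.1 (Finset.mem_coe.1 ha)
      refine ⟨a - 1, by omega, ?_⟩
      rw [Nat.sub_add_cancel this.1]
    obtain ⟨h1, h2⟩ := Nat.find_spec hE
    refine ⟨Nat.find hE, ?_, h2⟩
    rw [Finset.mem_filter, Finset.mem_range, not_le, ascent_iff_forall_not_heightSetoid he h1]
    refine ⟨h1, fun j hj1 hj2 hr => ?_⟩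
    obtain ⟨j, rfl⟩ : ∃ j', j = j' + 1 := ⟨j - 1, by omega⟩
    refine Nat.find_min hE (m := j) (by omega) ⟨by omega, ?_⟩
    rw [← h2]
    exact (heightPartition_part_eq_iff (by rw [Finset.mem_Icc]; omega)
        (by rw [Finset.mem_Icc]; omega)).2 hr

/-! ### Counting height codes -/

/-- Extending a code by one step either ascends to `e n + 1`, or moves to one of the heights
`1, …, e n`, which adds a non-ascent. -/
theorem sum_heightCodes_succ {M : Type*} [AddCommMonoid M] (n : ℕ) (φ : ℕ → ℕ → M) :
    ∑ e ∈ heightCodes (n + 1), φ (nonAscents (n + 1) e) (e (n + 1)) =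
      ∑ e ∈ heightCodes n,
        (φ (nonAscents n e) (e n + 1) + ∑ m ∈ Finset.Icc 1 (e n), φ (nonAscents n e + 1) m) := by
  classical
  rw [heightCodes, Finset.sum_biUnion]
  · refine Finset.sum_congr rfl fun e _ => ?_
    have hstep : ∀ m, nonAscents (n + 1) (Function.update e (n + 1) m) =
        nonAscents n e + if m ≤ e n then 1 else 0 := by
      intro m
      have : ∀ i ∈ Finset.range n,
          (Function.update e (n + 1) m (i + 1) ≤ Function.update e (n + 1) m i) =
            (e (i + 1) ≤ e i) := by
        intro i hi
        rw [Finset.mem_range] at hi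
        rw [Function.update_of_ne (by omega), Function.update_of_ne (by omega)]
      rw [nonAscents, Finset.range_add_one, Finset.filter_insert, Function.update_self,
        Function.update_of_ne (by omega), nonAscents, Finset.filter_congr_decidable]
      rw [Finset.filter_congr fun i hi => Iff.of_eq (this i hi)]
      split_ifs with h
      · rw [Finset.card_insert_of_notMem (by simp)]
      · rfl
    rw [Finset.sum_image fun a _ b _ h => by simpa using congrFun h (n + 1),
      Finset.sum_Icc_succ_top (by omega), add_comm]
    simp only [hstep, Function.update_self]
    congr 1
    · simp
    · refine Finset.sum_congr rfl fun m hm => ?_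
      rw [if_pos (Finset.mem_Icc.1 hm).2]
  · intro e he e' he' hne
    rw [Function.onFun, Finset.disjoint_left]
    intro f hf hf'
    obtain ⟨m, -, rfl⟩ := Finset.mem_image.1 hf
    obtain ⟨m', -, h⟩ := Finset.mem_image.1 hf'
    apply hne
    ext k
    rcases eq_or_ne k (n + 1) with rfl | hk
    · rw [(mem_heightCodes.1 he).2.2 _ (by omega), (mem_heightCodes.1 he').2.2 _ (by omega)]
    · simpa [Function.update_apply, hk] using (congrFun h k).symm

/-- The number of height codes of length `n` with `l` non-ascents and last height `m`. -/
noncomputable def codeCount (n l m : ℕ) : ℕ :=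
  ((heightCodes n).filter fun e => nonAscents n e = l ∧ e n = m).card

/-- The number of height codes of length `n` with `l` non-ascents and last height at least `m`. -/
noncomputable def codeTail (n l m : ℕ) : ℕ :=
  ((heightCodes n).filter fun e => nonAscents n e = l ∧ m ≤ e n).card

theorem height_le {n : ℕ} {e : ℕ → ℕ} (he : e ∈ heightCodes n) : ∀ i ≤ n, e i ≤ i := by
  obtain ⟨h0, hs, -⟩ := mem_heightCodes.1 he
  intro i
  induction i with
  | zero => intro _; exact h0.le
  | succ i ih =>
    intro hi
    have := (hs i hi).2
    have := ih (by omega)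
    omega

theorem codeTail_eq_add (n l m : ℕ) :
    codeTail n l m = codeCount n l m + codeTail n l (m + 1) := by
  classical
  rw [codeTail, codeCount, codeTail, ← Finset.card_union_of_disjoint]
  · congr 1
    ext e
    simp only [Finset.mem_filter, Finset.mem_union]
    have : m ≤ e n ↔ e n = m ∨ m + 1 ≤ e n := by omega
    rw [this]
    tauto
  · rw [Finset.disjoint_left]
    intro e h h'
    have h := (Finset.mem_filter.1 h).2.2
    have h' := (Finset.mem_filter.1 h').2.2
    omega

theorem codeTail_eq_zero {n m : ℕ} (l : ℕ) (h : n < m) : codeTail n l m = 0 := by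
  rw [codeTail, Finset.card_eq_zero, Finset.filter_eq_empty_iff]
  intro e he hh
  have := height_le he n le_rfl
  omega

theorem codeCount_succ_zero_right (n l : ℕ) : codeCount (n + 1) l 0 = 0 := by
  rw [codeCount, Finset.card_eq_zero, Finset.filter_eq_empty_iff]
  intro e he hh
  have := ((mem_heightCodes.1 he).2.1 n (by omega)).1
  omega

theorem codeCount_succ (n l m : ℕ) :
    codeCount (n + 1) l (m + 1) =
      codeCount n l m + if l = 0 then 0 else codeTail n (l - 1) (m + 1) := by
  have h := sum_heightCodes_succ n fun a b => if a = l ∧ b = m + 1 then 1 else 0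
  rw [codeCount, Finset.card_filter, h, Finset.sum_add_distrib, codeCount, Finset.card_filter]
  congr 1
  · exact Finset.sum_congr rfl fun e _ => by simp only [Nat.add_right_cancel_iff]
  · rcases l with _ | l
    · simp
    · rw [if_neg (by omega), Nat.add_sub_cancel, codeTail, Finset.card_filter]
      refine Finset.sum_congr rfl fun e _ => ?_
      by_cases h1 : nonAscents n e = l
      · simp [h1, Finset.sum_ite_eq', Finset.mem_Icc]
      · simp [h1]

theorem codeCount_zero_left (n m : ℕ) : codeCount n 0 m = if m = n then 1 else 0 := by
  induction n generalizing m with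
  | zero =>
    simp [codeCount, heightCodes, nonAscents, Finset.filter_singleton, eq_comm, apply_ite]
  | succ n ih =>
    rcases m with _ | m
    · rw [codeCount_succ_zero_right, if_neg (by omega)]
    · rw [codeCount_succ, ih, if_pos rfl, add_zero]
      simp

theorem codeTail_zero_left (m d : ℕ) : codeTail (m + d) 0 m = 1 := by
  induction d generalizing m with
  | zero => rw [codeTail_eq_add, codeTail_eq_zero _ (by omega), codeCount_zero_left]; simp
  | succ d ih =>
    rw [codeTail_eq_add, codeCount_zero_left, if_neg (by omega),
      show m + (d + 1) = m + 1 + d by omega, ih]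

theorem codeCount_succ_self (n l : ℕ) : codeCount n (l + 1) n = 0 := by
  induction n with
  | zero => simp [codeCount, nonAscents]
  | succ n ih => rw [codeCount_succ, ih, if_neg (by omega), codeTail_eq_zero _ (by omega)]

/-- The tail counts follow from the point counts by summation over the last height. -/
theorem mul_codeTail_of_mul_codeCount {n : ℕ}
    (h : ∀ l m d, m + d + 1 = n → n * codeCount n (l + 1) m = m * n.choose (l + 1) * d.choose l)
    (l m d : ℕ) (hd : m + d = n) :
    n * codeTail n l m = n.choose l * (m * d.choose l + d.choose (l + 1)) := by
  rcases l with _ | l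
  · subst hd
    rw [codeTail_zero_left]
    simp
  induction d generalizing m with
  | zero =>
    obtain rfl : m = n := by omega
    rw [codeTail_eq_add, codeTail_eq_zero _ (by omega), add_zero]
    simp [codeCount_succ_self]
  | succ d ih =>
    rw [codeTail_eq_add, mul_add, ih (m + 1) (by omega), h l m d (by omega),
      Nat.choose_succ_succ' d l, Nat.choose_succ_succ' d (l + 1)]
    ring

/-- The ballot-type formula for the number of codes with given last height; the index `d` is
`n - 1 - m`. -/
theorem mul_codeCount (n l m d : ℕ) (hd : m + d + 1 = n) :
    n * codeCount n (l + 1) m = m * n.choose (l + 1) * d.choose l := by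
  induction n generalizing l m d with
  | zero => omega
  | succ n ih =>
    rcases m with _ | m
    · rw [codeCount_succ_zero_right]
      simp
    have hn : n = m + 1 + d := by omega
    have h1 := ih (l := l) (m := m) (d := d) (by omega)
    have h2 := mul_codeTail_of_mul_codeCount (fun l m d => ih l m d) l (m + 1) d (by omega)
    rw [codeCount_succ, if_neg (by omega), Nat.add_sub_cancel]
    -- Both sides are compared after multiplication by `n (l + 1)`.
    have h3 : ((n.choose (l + 1) : ℕ) : ℚ) * (l + 1) = n.choose l * (n - l) := by
      rcases Nat.lt_or_ge n l with h | h
      · rw [Nat.choose_eq_zero_of_lt h, Nat.choose_eq_zero_of_lt (by omega)]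
        simp
      · rw [← Nat.cast_sub h]
        exact_mod_cast Nat.choose_succ_right_eq n l
    have h4 : ((d.choose (l + 1) : ℕ) : ℚ) * (l + 1) = d.choose l * (d - l) := by
      rcases Nat.lt_or_ge d l with h | h
      · rw [Nat.choose_eq_zero_of_lt h, Nat.choose_eq_zero_of_lt (by omega)]
        simp
      · rw [← Nat.cast_sub h]
        exact_mod_cast Nat.choose_succ_right_eq d l
    have h5 : (((n + 1).choose (l + 1) : ℕ) : ℚ) = n.choose l + n.choose (l + 1) := by
      exact_mod_cast Nat.choose_succ_succ' n l
    have hl : (l : ℚ) + 1 ≠ 0 := by positivity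
    have hnQ : (n : ℚ) = m + 1 + d := by exact_mod_cast hn
    have hn0 : (n : ℚ) ≠ 0 := by rw [hnQ]; positivity
    have h1 : (n : ℚ) * codeCount n (l + 1) m = m * n.choose (l + 1) * d.choose l := by
      exact_mod_cast h1
    have h2 : (n : ℚ) * codeTail n l (m + 1) =
        n.choose l * ((m + 1) * d.choose l + d.choose (l + 1)) := by
      exact_mod_cast h2
    have goal : ((n : ℚ) + 1) * (codeCount n (l + 1) m + codeTail n l (m + 1)) =
        (m + 1) * (n + 1).choose (l + 1) * d.choose l := by
      apply mul_left_cancel₀ hn0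
      apply mul_left_cancel₀ hl
      rw [h5]
      have e3 : ((n.choose (l + 1) : ℕ) : ℚ) = n.choose l * (n - l) / (l + 1) := by
        rw [eq_div_iff hl, h3]
      have e4 : ((d.choose (l + 1) : ℕ) : ℚ) = d.choose l * (d - l) / (l + 1) := by
        rw [eq_div_iff hl, h4]
      have e1 : (codeCount n (l + 1) m : ℚ) = m * n.choose (l + 1) * d.choose l / n := by
        rw [eq_div_iff hn0, ← h1]; ring
      have e2 : (codeTail n l (m + 1) : ℚ) =
          n.choose l * ((m + 1) * d.choose l + d.choose (l + 1)) / n := by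
        rw [eq_div_iff hn0, ← h2]; ring
      rw [e1, e2, e3, e4]
      field_simp
      rw [hnQ]
      ring
    exact_mod_cast goal

/-- The Narayana numbers: `n` times the number of codes with `l` non-ascents is
`C(n, l) * C(n, l + 1)`. -/
theorem mul_card_heightCodes_nonAscents {n : ℕ} (hn : 1 ≤ n) (l : ℕ) :
    n * ((heightCodes n).filter fun e => nonAscents n e = l).card =
      n.choose l * n.choose (l + 1) := by
  obtain ⟨d, rfl⟩ : ∃ d, n = d + 1 := ⟨n - 1, by omega⟩
  have h := mul_codeTail_of_mul_codeCount (mul_codeCount (d + 1)) l 1 d (by omega)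
  rw [codeTail, one_mul, ← Nat.choose_succ_succ'] at h
  rw [← h]
  congr 2
  refine Finset.filter_congr fun e he => ?_
  have := ((mem_heightCodes.1 he).2.1 d (by omega)).1
  simp [this]

/-! ### The law of the number of blocks -/

/-- Expectations over a random non-crossing partition are averages over height codes. -/
theorem integral_uniformNC {E : Type*} [NormedAddCommGroup E] [NormedSpace ℝ E]
    [CompleteSpace E] (n : ℕ) (f : Finpartition (Finset.Icc 1 n) → E) :
    ∫ P, f P ∂(uniformNC n) = ((heightCodes n).card : ℝ)⁻¹ •
      ∑ e ∈ heightCodes n, f (heightPartition n e) := by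
  classical
  have himg : ((heightCodes n).image (heightPartition n) : Set _) = NC n := by
    rw [Finset.coe_image]
    exact ((heightPartition_surjOn n).image_eq_of_mapsTo fun e _ => heightPartition_mem_NC n e)
  have hcard : ((heightCodes n).image (heightPartition n)).card = (heightCodes n).card :=
    Finset.card_image_of_injOn (heightPartition_injOn n)
  rw [integral_fintype (.of_finite), ← Finset.sum_image (heightPartition_injOn n), Finset.smul_sum,
    ← Finset.sum_subset (Finset.subset_univ ((heightCodes n).image (heightPartition n)))]
  · refine Finset.sum_congr rfl fun P hP => ?_
    congr 1
    rw [uniformNC, ← himg, measureReal_def, ← Finset.coe_singleton, uniformOn_apply_finset,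
      Finset.inter_singleton_of_mem hP, hcard]
    simp
  · intro P _ hP
    rw [uniformNC, ← himg, measureReal_def, ← Finset.coe_singleton, uniformOn_apply_finset,
      Finset.inter_singleton_of_notMem hP]
    simp

theorem sum_heightCodes_numBlocks {M : Type*} [AddCommMonoid M] [Module ℝ M] {n : ℕ} (hn : 1 ≤ n)
    (g : ℝ → M) :
    (n : ℝ) • ∑ e ∈ heightCodes n, g (numBlocks n (heightPartition n e)) =
      ∑ l ∈ Finset.range n, ((n.choose l * n.choose (l + 1) : ℕ) : ℝ) • g (n - l) := by
  have hmaps : ∀ e ∈ heightCodes n, nonAscents n e ∈ Finset.range n := by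
    intro e he
    rw [Finset.mem_range]
    have h1 := card_parts_heightPartition he
    have h2 : 0 < (heightPartition n e).parts.card := by
      rw [Finset.card_pos]
      exact Finpartition.parts_nonempty _ (Finset.nonempty_iff_ne_empty.1 ⟨1, by simpa using hn⟩)
    omega
  rw [← Finset.sum_fiberwise_of_maps_to hmaps, Finset.smul_sum]
  refine Finset.sum_congr rfl fun l hl => ?_
  rw [← mul_card_heightCodes_nonAscents hn l, Finset.sum_congr rfl (g := fun _ => g (n - l)),
    Finset.sum_const, ← Nat.cast_smul_eq_nsmul ℝ, smul_smul, Nat.cast_mul]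
  intro e he
  rw [Finset.mem_filter] at he
  have h1 := card_parts_heightPartition he.1
  rw [numBlocks, ← he.2]
  congr 1
  rw [eq_sub_iff_add_eq]
  exact_mod_cast h1

theorem sum_range_choose_mul_choose_succ (n : ℕ) :
    ∑ l ∈ Finset.range n, n.choose l * n.choose (l + 1) = (2 * n).choose (n + 1) := by
  rcases n with _ | n
  · simp
  rw [← Nat.choose_symm_of_eq_add (n := 2 * (n + 1)) (a := n) (b := n + 1 + 1) (by omega),
    two_mul, Nat.add_choose_eq, Finset.Nat.sum_antidiagonal_eq_sum_range_succ_mk]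
  refine Finset.sum_congr rfl fun l hl => ?_
  rw [Finset.mem_range] at hl
  rw [Nat.choose_symm_of_eq_add (n := n + 1) (a := n - l) (b := l + 1) (by omega)]

/-- The law of the number of blocks is hypergeometric: `n - X_n` takes the value `l` with
probability proportional to `C(n, l) * C(n, n - 1 - l)`. -/
theorem integral_numBlocks {E : Type*} [NormedAddCommGroup E] [NormedSpace ℝ E] [CompleteSpace E]
    {n : ℕ} (hn : 1 ≤ n) (g : ℝ → E) :
    ∫ P, g (numBlocks n P) ∂(uniformNC n) = ((2 * n).choose (n + 1) : ℝ)⁻¹ •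
      ∑ l ∈ Finset.range n, ((n.choose l * n.choose (l + 1) : ℕ) : ℝ) • g (n - l) := by
  have hn0 : (n : ℝ) ≠ 0 := by positivity
  have h1 := sum_heightCodes_numBlocks hn (fun _ => (1 : ℝ))
  simp only [smul_eq_mul, Finset.sum_const, nsmul_eq_mul, mul_one] at h1
  rw [← Nat.cast_sum, sum_range_choose_mul_choose_succ] at h1
  rw [integral_uniformNC, ← sum_heightCodes_numBlocks hn, ← h1, smul_smul, mul_inv,
    mul_comm (n : ℝ)⁻¹, mul_assoc, inv_mul_cancel₀ hn0, mul_one]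

/-! ### Mean and variance -/

theorem choose_succ_pos {n : ℕ} (hn : 1 ≤ n) : (0 : ℝ) < (2 * n).choose (n + 1) := by
  exact_mod_cast Nat.choose_pos (by omega)

theorem mean_numBlocks {n : ℕ} (hn : 1 ≤ n) :
    ∫ P, numBlocks n P ∂(uniformNC n) = ((n : ℝ) + 1) / 2 := by
  have hpos := choose_succ_pos hn
  rw [integral_numBlocks hn fun x => x]
  simp only [smul_eq_mul]
  set S := ∑ l ∈ Finset.range n, ((n.choose l * n.choose (l + 1) : ℕ) : ℝ) * (n - l) with hS
  -- The weights are symmetric under `l ↦ n - 1 - l`.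
  have hrefl : S = ∑ l ∈ Finset.range n, ((n.choose l * n.choose (l + 1) : ℕ) : ℝ) * (l + 1) := by
    rw [hS, ← Finset.sum_range_reflect]
    refine Finset.sum_congr rfl fun l hl => ?_
    rw [Finset.mem_range] at hl
    rw [Nat.choose_symm_of_eq_add (n := n) (a := n - 1 - l) (b := l + 1) (by omega),
      Nat.choose_symm_of_eq_add (n := n) (a := n - 1 - l + 1) (b := l) (by omega),
      mul_comm (n.choose (l + 1))]
    congr 1
    rw [sub_eq_iff_eq_add]
    have : n = l + 1 + (n - 1 - l) := by omega
    exact_mod_cast this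
  have hsum : 2 * S = (n + 1) * (2 * n).choose (n + 1) := by
    rw [two_mul]
    nth_rewrite 2 [hrefl]
    rw [hS, ← Finset.sum_add_distrib, ← sum_range_choose_mul_choose_succ, Nat.cast_sum,
      Finset.mul_sum]
    exact Finset.sum_congr rfl fun l _ => by ring
  rw [inv_mul_eq_div, div_eq_div_iff hpos.ne' two_ne_zero]
  linarith

/-- The mixed moment `E (X_n (n + 1 - X_n))`, in which the weights absorb the factors. -/
theorem mixed_moment_numBlocks {n : ℕ} (hn : 1 ≤ n) :
    ∫ P, numBlocks n P * (n + 1 - numBlocks n P) ∂(uniformNC n) =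
      (n : ℝ) ^ 2 * (n + 1) / (2 * (2 * n - 1)) := by
  have hpos := choose_succ_pos hn
  rw [integral_numBlocks hn fun x => x * (n + 1 - x)]
  obtain ⟨m, rfl⟩ : ∃ m, n = m + 1 := ⟨n - 1, by omega⟩
  have hsum : ∑ l ∈ Finset.range (m + 1),
      (((m + 1).choose l * (m + 1).choose (l + 1) : ℕ) : ℝ) •
        (((m + 1 : ℕ) - l : ℝ) * ((m + 1 : ℕ) + 1 - ((m + 1 : ℕ) - l))) =
      ((m : ℝ) + 1) ^ 2 * (2 * m).choose m := by
    rw [← Nat.sum_range_choose_sq, Nat.cast_sum, Finset.mul_sum]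
    refine Finset.sum_congr rfl fun l hl => ?_
    rw [Finset.mem_range] at hl
    have h1 : (((m + 1).choose (l + 1) : ℕ) : ℝ) * (l + 1) = (m + 1) * m.choose l := by
      exact_mod_cast (Nat.add_one_mul_choose_eq m l).symm
    have h2 : (((m + 1).choose l : ℕ) : ℝ) * (m + 1 - l) = (m + 1) * m.choose l := by
      rw [← h1]
      have := Nat.choose_succ_right_eq (m + 1) l
      have h3 : ((m + 1 - l : ℕ) : ℝ) = m + 1 - l := by
        rw [Nat.cast_sub (by omega)]; push_cast; ring
      rw [← h3]
      exact_mod_cast this.symm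
    rw [smul_eq_mul]
    push_cast
    linear_combination ((m + 1).choose (l + 1) : ℝ) * (l + 1) * h2 +
      ((m + 1) * m.choose l : ℝ) * h1
  have hc : ((2 * (m + 1)).choose (m + 1 + 1) : ℝ) * (m + 2) =
      2 * (2 * m + 1) * (2 * m).choose m := by
    have h1 := Nat.choose_succ_right_eq (2 * (m + 1)) (m + 1)
    have h2 := Nat.succ_mul_centralBinom_succ m
    rw [Nat.centralBinom_eq_two_mul_choose, Nat.centralBinom_eq_two_mul_choose] at h2
    rw [show 2 * (m + 1) - (m + 1) = m + 1 by omega, mul_comm (Nat.choose _ (m + 1)) (m + 1),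
      h2] at h1
    have h1' : (((2 * (m + 1)).choose (m + 1 + 1) : ℕ) : ℝ) * ((m : ℝ) + 1 + 1) =
      2 * (2 * m + 1) * (2 * m).choose m := by exact_mod_cast h1
    rw [← h1']
    ring
  have hm : (0 : ℝ) < 2 * (2 * (m + 1 : ℕ) - 1) := by push_cast; linarith [m.cast_nonneg (α := ℝ)]
  rw [hsum, smul_eq_mul, inv_mul_eq_div, div_eq_div_iff hpos.ne' hm.ne']
  push_cast
  linear_combination (-(m + 1) ^ 2 : ℝ) * hc

theorem variance_numBlocks {n : ℕ} (hn : 1 ≤ n) :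
    variance (numBlocks n) (uniformNC n) = ((n : ℝ) ^ 2 - 1) / (4 * (2 * (n : ℝ) - 1)) := by
  have hn1 : (1 : ℝ) ≤ n := by exact_mod_cast hn
  have hm : (2 * (n : ℝ) - 1) ≠ 0 := by linarith
  have h2 : ∫ P, numBlocks n P ^ 2 ∂(uniformNC n) =
      (n + 1) * ∫ P, numBlocks n P ∂(uniformNC n) -
        ∫ P, numBlocks n P * (n + 1 - numBlocks n P) ∂(uniformNC n) := by
    rw [← integral_const_mul, ← integral_sub .of_finite .of_finite]
    congr 1 with P
    ring
  rw [variance_eq_sub (MemLp.of_discrete)]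
  simp only [Pi.pow_apply]
  rw [h2, mixed_moment_numBlocks hn, mean_numBlocks hn]
  obtain ⟨d, hd⟩ : ∃ d, d = 2 * (n : ℝ) - 1 := ⟨_, rfl⟩
  rw [← hd] at hm ⊢
  rw [show (n : ℝ) = (d + 1) / 2 by linarith]
  field_simp
  ring

/-! ### An integral representation of the characteristic function -/

/-- The integral of `((cos s + cos θ) / 2) ^ n * exp (-iθ)` over `[-π, π]`, which extracts the
coefficient of `w` in the Laurent polynomial obtained by writing `w = exp (iθ)`. -/
noncomputable def cosPowIntegral (n : ℕ) (s : ℝ) : ℂ :=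
  ∫ θ in (-Real.pi)..Real.pi,
    (((Real.cos s + Real.cos θ) / 2 : ℝ) : ℂ) ^ n * Complex.exp (-(θ * Complex.I))

theorem integral_exp_int_mul_I (k : ℤ) :
    ∫ θ in (-Real.pi)..Real.pi, Complex.exp (k * θ * Complex.I) =
      if k = 0 then 2 * (Real.pi : ℂ) else 0 := by
  split_ifs with hk
  · simp [hk]
    ring
  · have hc : (k : ℂ) * Complex.I ≠ 0 := mul_ne_zero (by exact_mod_cast hk) Complex.I_ne_zero
    have h := integral_exp_mul_complex (a := -Real.pi) (b := Real.pi) hc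
    have h2 : Complex.exp (k * Complex.I * (Real.pi : ℝ)) =
        Complex.exp (k * Complex.I * ((-Real.pi : ℝ) : ℂ)) := by
      rw [Complex.exp_eq_exp_iff_exists_int]
      exact ⟨k, by push_cast; ring⟩
    rw [h2, sub_self, zero_div] at h
    rw [← h]
    congr 1 with θ
    ring_nf

/-- With `a = exp (is)` and `w = exp (iθ)` one has
`2 cos s + 2 cos θ = (1 + (a w)⁻¹) * (w + a)`; both factors are expanded by the binomial theorem. -/
theorem cosPow_expansion (n : ℕ) (s θ : ℝ) :
    4 ^ n * ((((Real.cos s + Real.cos θ) / 2 : ℝ) : ℂ) ^ n * Complex.exp (-(θ * Complex.I))) =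
      ∑ j ∈ Finset.range (n + 1), ∑ i ∈ Finset.range (n + 1),
        (n.choose j * n.choose i : ℂ) * Complex.exp (s * (n - i - j) * Complex.I) *
          Complex.exp (((i - j - 1 : ℤ) : ℂ) * θ * Complex.I) := by
  set a := Complex.exp (s * Complex.I) with ha
  set w := Complex.exp (θ * Complex.I) with hw
  have ha' : a⁻¹ = Complex.exp (-(s * Complex.I)) := (Complex.exp_neg _).symm
  have hw' : w⁻¹ = Complex.exp (-(θ * Complex.I)) := (Complex.exp_neg _).symm
  have ha0 : a ≠ 0 := Complex.exp_ne_zero _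
  have hw0 : w ≠ 0 := Complex.exp_ne_zero _
  have hfac : (4 : ℂ) * (((Real.cos s + Real.cos θ) / 2 : ℝ) : ℂ) =
      ((a * w)⁻¹ + 1) * (w + a) := by
    have h1 : (2 : ℂ) * Complex.cos s = a + a⁻¹ := by
      rw [Complex.two_cos, ha', neg_mul]
    have h2 : (2 : ℂ) * Complex.cos θ = w + w⁻¹ := by
      rw [Complex.two_cos, hw', neg_mul]
    push_cast
    rw [show (4 : ℂ) * ((Complex.cos s + Complex.cos θ) / 2) =
      2 * Complex.cos s + 2 * Complex.cos θ by ring, h1, h2]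
    field_simp
    ring
  rw [← mul_assoc, ← mul_pow, hfac, mul_pow, add_pow, add_pow, Finset.sum_mul_sum, Finset.sum_mul]
  refine Finset.sum_congr rfl fun j _ => ?_
  rw [Finset.sum_mul]
  refine Finset.sum_congr rfl fun i hi => ?_
  have hi : i ≤ n := by rw [Finset.mem_range] at hi; omega
  rw [one_pow, mul_one, mul_inv, mul_pow, ha', hw', ha, hw]
  simp only [← Complex.exp_nat_mul]
  have : Complex.exp (s * (n - i - j) * Complex.I) *
        Complex.exp (((i - j - 1 : ℤ) : ℂ) * θ * Complex.I) =
      Complex.exp (j * -(s * Complex.I)) * Complex.exp (j * -(θ * Complex.I)) *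
        (Complex.exp (i * (θ * Complex.I)) * Complex.exp ((n - i : ℕ) * (s * Complex.I))) *
        Complex.exp (-(θ * Complex.I)) := by
    simp only [← Complex.exp_add]
    congr 1
    push_cast [Nat.cast_sub hi]
    ring
  rw [mul_assoc _ (Complex.exp _) (Complex.exp _), this]
  ring

theorem cosPowIntegral_eq_sum (n : ℕ) (s : ℝ) :
    4 ^ n * cosPowIntegral n s = 2 * Real.pi * ∑ l ∈ Finset.range n,
      ((n.choose l * n.choose (l + 1) : ℕ) : ℂ) *
        Complex.exp (s * (n - 1 - 2 * l) * Complex.I) := by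
  rw [cosPowIntegral, ← intervalIntegral.integral_const_mul]
  simp_rw [cosPow_expansion]
  rw [intervalIntegral.integral_finsetSum fun j _ =>
    Continuous.intervalIntegrable (by fun_prop) _ _]
  rw [Finset.sum_range_succ, Finset.mul_sum]
  -- Orthogonality keeps only `i = j + 1`.
  have hrow : ∀ j, ∫ θ in (-Real.pi)..Real.pi, ∑ i ∈ Finset.range (n + 1),
        (n.choose j * n.choose i : ℂ) * Complex.exp (s * (n - i - j) * Complex.I) *
          Complex.exp (((i - j - 1 : ℤ) : ℂ) * θ * Complex.I) =
      if j + 1 ∈ Finset.range (n + 1) then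
        (n.choose j * n.choose (j + 1) : ℂ) *
          Complex.exp (s * (n - (j + 1 : ℕ) - j) * Complex.I) * (2 * Real.pi) else 0 := by
    intro j
    rw [intervalIntegral.integral_finsetSum fun i _ =>
      Continuous.intervalIntegrable (by fun_prop) _ _, ← Finset.sum_ite_eq' _ _ fun i =>
        (n.choose j * n.choose i : ℂ) * Complex.exp (s * (n - i - j) * Complex.I) * (2 * Real.pi)]
    refine Finset.sum_congr rfl fun i _ => ?_
    rw [intervalIntegral.integral_const_mul, integral_exp_int_mul_I]
    by_cases h : i = j + 1
    · rw [if_pos h, if_pos (by omega), h]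
    · rw [if_neg h, if_neg (by omega), mul_zero]
  simp_rw [hrow]
  rw [if_neg (by simp), add_zero]
  refine Finset.sum_congr rfl fun l hl => ?_
  rw [if_pos (by simpa using hl), mul_comm]
  congr 1
  push_cast
  congr 3
  ring

/-- The characteristic function of `2 X_n - (n + 1)`. -/
theorem integral_exp_numBlocks {n : ℕ} (hn : 1 ≤ n) (s : ℝ) :
    ∫ P, Complex.exp (s * (2 * numBlocks n P - (n + 1)) * Complex.I) ∂(uniformNC n) =
      cosPowIntegral n s / cosPowIntegral n 0 := by
  have hpos : ((2 * n).choose (n + 1) : ℂ) ≠ 0 := by exact_mod_cast (choose_succ_pos hn).ne'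
  have h4 : (4 : ℂ) ^ n ≠ 0 := pow_ne_zero _ (by norm_num)
  have hpi : (2 * Real.pi : ℂ) ≠ 0 := by exact_mod_cast Real.two_pi_pos.ne'
  have h0 := cosPowIntegral_eq_sum n 0
  simp only [Complex.ofReal_zero, zero_mul, Complex.exp_zero, mul_one] at h0
  rw [← Nat.cast_sum, sum_range_choose_mul_choose_succ] at h0
  rw [integral_numBlocks hn fun x => Complex.exp (s * (2 * x - (n + 1)) * Complex.I),
    ← mul_div_mul_left _ _ h4, h0, cosPowIntegral_eq_sum, mul_div_mul_left _ _ hpi,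
    Complex.real_smul, div_eq_inv_mul]
  push_cast
  congr 1
  refine Finset.sum_congr rfl fun l _ => ?_
  rw [Complex.real_smul]
  push_cast
  congr 3
  ring

/-! ### Asymptotics of the integral -/

/-- If `√n * u n → b`, then `n * (cos (u n) - 1) → -b² / 2`, by `cos u - 1 = -2 sin² (u / 2)`. -/
theorem tendsto_mul_cos_sub_one {u : ℕ → ℝ} {b : ℝ}
    (hu : Tendsto (fun n : ℕ => √(n : ℝ) * u n) atTop (𝓝 b)) :
    Tendsto (fun n : ℕ => (n : ℝ) * (Real.cos (u n) - 1)) atTop (𝓝 (-b ^ 2 / 2)) := by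
  have hu0 : Tendsto u atTop (𝓝 0) := by
    have h1 : Tendsto (fun n : ℕ => (√(n : ℝ))⁻¹) atTop (𝓝 0) :=
      tendsto_inv_atTop_zero.comp (Real.tendsto_sqrt_atTop.comp tendsto_natCast_atTop_atTop)
    have h2 := h1.mul hu
    rw [zero_mul] at h2
    refine h2.congr' ?_
    filter_upwards [eventually_ge_atTop 1] with n hn
    have : √(n : ℝ) ≠ 0 := by positivity
    field_simp
  have hsinc : Tendsto (fun n => Real.sinc (u n / 2)) atTop (𝓝 1) := by
    have := (Real.continuous_sinc.tendsto (0 / 2)).comp (hu0.div_const 2)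
    rw [zero_div, Real.sinc_zero] at this
    exact this
  have h := ((hu.pow 2).mul (hsinc.pow 2)).const_mul (-1 / 2)
  have hlim : (-1 / 2 : ℝ) * (b ^ 2 * 1 ^ 2) = -b ^ 2 / 2 := by ring
  rw [hlim] at h
  refine h.congr fun n => ?_
  have hs : Real.sin (u n / 2) = u n / 2 * Real.sinc (u n / 2) := by
    by_cases h0 : u n / 2 = 0
    · simp [h0]
    · rw [Real.sinc_of_ne_zero h0, mul_div_cancel₀ _ h0]
  have hc : Real.cos (u n) = 1 - 2 * Real.sin (u n / 2) ^ 2 := by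
    have := Real.cos_two_mul (u n / 2)
    rw [show 2 * (u n / 2) = u n by ring] at this
    rw [this, Real.cos_sq']
    ring
  rw [hc, hs, mul_pow, Real.sq_sqrt n.cast_nonneg]
  ring

/-- The Gaussian bound that dominates the rescaled integrands, uniformly in `|s| ≤ 1`. -/
theorem abs_cos_add_cos_le {s θ : ℝ} (hs : |s| ≤ 1) (hθ : |θ| ≤ Real.pi) :
    |(Real.cos s + Real.cos θ) / 2| ≤ Real.exp (-(θ ^ 2 / Real.pi ^ 2)) := by
  have hpi := Real.pi_pos
  rw [abs_le]
  constructor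
  · -- Near `θ = ±π` the quotient is slightly negative, but at least `-1 / 4 ≥ -exp (-1)`.
    have h1 := Real.one_sub_sq_div_two_le_cos (x := s)
    have h2 := Real.neg_one_le_cos θ
    have h3 : s ^ 2 ≤ 1 := by rwa [sq_le_one_iff_abs_le_one]
    have h4 : θ ^ 2 / Real.pi ^ 2 ≤ 1 := by
      rw [div_le_one (by positivity), ← sq_abs θ]
      gcongr
    have h5 : Real.exp (-1) ≤ Real.exp (-(θ ^ 2 / Real.pi ^ 2)) :=
      Real.exp_le_exp.2 (by linarith)
    have h6 : (1 / 4 : ℝ) ≤ Real.exp (-1) := by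
      rw [Real.exp_neg, ← one_div]
      exact one_div_le_one_div_of_le (Real.exp_pos 1) (by linarith [Real.exp_one_lt_d9])
    linarith
  · have h1 := Real.cos_le_one s
    have h2 := Real.cos_le_one_sub_mul_cos_sq hθ
    have h3 := Real.add_one_le_exp (-(θ ^ 2 / Real.pi ^ 2))
    have h4 : 2 / Real.pi ^ 2 * θ ^ 2 = 2 * (θ ^ 2 / Real.pi ^ 2) := by ring
    linarith

/-- Laplace's method: after the substitution `θ = φ / √n` the integrand converges to a Gaussian,
dominated by `exp (-φ² / π²)`. -/
theorem tendsto_sqrt_mul_cosPowIntegral {s : ℕ → ℝ} {a : ℝ}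
    (hs : Tendsto (fun n : ℕ => √(n : ℝ) * s n) atTop (𝓝 a)) (hs0 : Tendsto s atTop (𝓝 0)) :
    Tendsto (fun n : ℕ => ((√(n : ℝ) : ℝ) : ℂ) * cosPowIntegral n (s n)) atTop
      (𝓝 (Real.exp (-a ^ 2 / 4) * √(4 * Real.pi) : ℝ)) := by
  set F : ℕ → ℝ → ℂ := fun n φ =>
    (((Real.cos (s n) + Real.cos (φ / √(n : ℝ))) / 2 : ℝ) : ℂ) ^ n *
      Complex.exp (-((φ / √(n : ℝ) : ℝ) * Complex.I)) with hF
  set I : ℕ → Set ℝ := fun n => Set.Ioc (-Real.pi * √(n : ℝ)) (Real.pi * √(n : ℝ)) with hI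
  have hsqrt : Tendsto (fun n : ℕ => √(n : ℝ)) atTop atTop :=
    Real.tendsto_sqrt_atTop.comp tendsto_natCast_atTop_atTop
  have hlim : ∫ φ : ℝ, ((Real.exp (-(a ^ 2 + φ ^ 2) / 4) : ℝ) : ℂ) =
      (Real.exp (-a ^ 2 / 4) * √(4 * Real.pi) : ℝ) := by
    rw [integral_complex_ofReal]
    congr 1
    have h : ∀ φ : ℝ, Real.exp (-(a ^ 2 + φ ^ 2) / 4) =
        Real.exp (-a ^ 2 / 4) * Real.exp (-(1 / 4) * φ ^ 2) := by
      intro φ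
      rw [← Real.exp_add]
      congr 1
      ring
    simp_rw [h]
    rw [integral_const_mul, integral_gaussian]
    congr 2
    ring
  rw [← hlim]
  have hDCT : Tendsto (fun n => ∫ φ, (I n).indicator (F n) φ) atTop
      (𝓝 (∫ φ : ℝ, ((Real.exp (-(a ^ 2 + φ ^ 2) / 4) : ℝ) : ℂ))) := by
    refine tendsto_integral_filter_of_dominated_convergence
      (fun φ => Real.exp (-(1 / Real.pi ^ 2) * φ ^ 2)) ?_ ?_ ?_ ?_
    · refine Eventually.of_forall fun n => ?_
      exact (Continuous.aestronglyMeasurable (by fun_prop)).indicator measurableSet_Ioc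
    · have h1 : ∀ᶠ n in atTop, |s n| ≤ 1 := by
        have := hs0.abs
        rw [abs_zero] at this
        exact this.eventually_le_const one_pos
      filter_upwards [h1, eventually_ge_atTop 1] with n hn hn1
      refine Eventually.of_forall fun φ => ?_
      by_cases hφ : φ ∈ I n
      · have hsq : 0 < √(n : ℝ) := by positivity
        have hθ : |φ / √(n : ℝ)| ≤ Real.pi := by
          rw [abs_div, abs_of_pos hsq, div_le_iff₀ hsq, abs_le]
          exact ⟨by linarith [hφ.1], hφ.2⟩
        have hb := abs_cos_add_cos_le hn hθ
        rw [Set.indicator_of_mem hφ, hF]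
        simp only [norm_mul, norm_pow, Complex.norm_real, Real.norm_eq_abs]
        rw [← neg_mul, ← Complex.ofReal_neg, Complex.norm_exp_ofReal_mul_I, mul_one]
        refine (pow_le_pow_left₀ (abs_nonneg _) hb n).trans (le_of_eq ?_)
        rw [← Real.exp_nat_mul, div_pow, Real.sq_sqrt n.cast_nonneg]
        congr 1
        field_simp
      · rw [Set.indicator_of_notMem hφ, norm_zero]
        positivity
    · exact integrable_exp_neg_mul_sq (by positivity)
    · refine Eventually.of_forall fun φ => ?_
      have hφ : Tendsto (fun n : ℕ => φ / √(n : ℝ)) atTop (𝓝 0) := hsqrt.const_div_atTop φ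
      have hφ' : Tendsto (fun n : ℕ => √(n : ℝ) * (φ / √(n : ℝ))) atTop (𝓝 φ) := by
        refine tendsto_const_nhds.congr' ?_
        filter_upwards [eventually_ge_atTop 1] with n hn
        have : √(n : ℝ) ≠ 0 := by positivity
        field_simp
      have hpow : Tendsto (fun n : ℕ =>
          ((Real.cos (s n) + Real.cos (φ / √(n : ℝ))) / 2) ^ n) atTop
          (𝓝 (Real.exp (-(a ^ 2 + φ ^ 2) / 4))) := by
        have h := ((tendsto_mul_cos_sub_one hs).add (tendsto_mul_cos_sub_one hφ')).div_const 2
        have h' := Real.tendsto_one_add_pow_exp_of_tendsto (g := fun n =>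
          (Real.cos (s n) - 1 + (Real.cos (φ / √(n : ℝ)) - 1)) / 2)
          (h.congr fun n => by ring)
        rw [show (-a ^ 2 / 2 + -φ ^ 2 / 2) / 2 = -(a ^ 2 + φ ^ 2) / 4 by ring] at h'
        exact h'.congr fun n => by ring
      have hexp : Tendsto (fun n : ℕ => Complex.exp (-((φ / √(n : ℝ) : ℝ) * Complex.I))) atTop
          (𝓝 1) := by
        have hc : Continuous fun x : ℝ => Complex.exp (-(x * Complex.I)) := by fun_prop
        have := (hc.tendsto 0).comp hφ
        rw [Complex.ofReal_zero, zero_mul, neg_zero, Complex.exp_zero] at this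
        exact this
      have hFlim := ((Complex.continuous_ofReal.tendsto _).comp hpow).mul hexp
      rw [mul_one] at hFlim
      refine hFlim.congr' ?_
      filter_upwards [(hsqrt.const_mul_atTop Real.pi_pos).eventually_gt_atTop |φ|] with n hn
      rw [abs_lt] at hn
      rw [Set.indicator_of_mem (show φ ∈ I n from ⟨by linarith [hn.1], hn.2.le⟩), hF]
      simp
  refine hDCT.congr' ?_
  filter_upwards [eventually_ge_atTop 1] with n hn
  have hsq : 0 < √(n : ℝ) := by positivity
  rw [integral_indicator measurableSet_Ioc, ← intervalIntegral.integral_of_le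
    (by nlinarith [Real.pi_pos]), cosPowIntegral, hF]
  rw [intervalIntegral.integral_comp_div (fun θ : ℝ =>
    (((Real.cos (s n) + Real.cos θ) / 2 : ℝ) : ℂ) ^ n * Complex.exp (-(θ * Complex.I))) hsq.ne',
    mul_div_cancel_right₀ _ hsq.ne', mul_div_cancel_right₀ _ hsq.ne', Complex.real_smul]

/-! ### The central limit theorem -/

theorem tendsto_variance_div :
    Tendsto (fun n : ℕ => variance (numBlocks n) (uniformNC n) / n) atTop (𝓝 (1 / 8)) := by
  have hinv : Tendsto (fun n : ℕ => (n : ℝ)⁻¹) atTop (𝓝 0) :=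
    tendsto_inv_atTop_zero.comp tendsto_natCast_atTop_atTop
  have h := ((hinv.pow 2).const_sub 1).div ((hinv.const_sub 2).const_mul 4) (by norm_num)
  rw [show ((1 : ℝ) - 0 ^ 2) / (4 * (2 - 0)) = 1 / 8 by norm_num] at h
  refine h.congr' ?_
  filter_upwards [eventually_ge_atTop 1] with n hn
  have hn1 : (1 : ℝ) ≤ n := by exact_mod_cast hn
  have hn0 : (n : ℝ) ≠ 0 := by positivity
  have h1 : (2 : ℝ) - (n : ℝ)⁻¹ ≠ 0 := by
    have := inv_le_one_of_one_le₀ hn1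
    linarith
  have h2 : 2 * (n : ℝ) - 1 ≠ 0 := by linarith
  rw [variance_numBlocks hn, Pi.div_apply, div_div,
    div_eq_div_iff (by simpa using h1) (by simpa [hn0] using h2)]
  field_simp

/-- For `n = 1` the variance vanishes, and both sides are `1` by the convention `x / 0 = 0`. -/
theorem charFun_stdNumBlocks {n : ℕ} (hn : 1 ≤ n) (t : ℝ) :
    charFun ((uniformNC n).map (stdNumBlocks n)) t =
      cosPowIntegral n (t / (2 * √(variance (numBlocks n) (uniformNC n)))) /
        cosPowIntegral n 0 := by
  rw [charFun_apply_real, integral_map (Measurable.of_discrete).aemeasurable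
    (Continuous.aestronglyMeasurable (by fun_prop)), ← integral_exp_numBlocks hn]
  congr 1 with P
  congr 2
  rw [stdNumBlocks, mean_numBlocks hn]
  push_cast
  rw [div_mul_eq_mul_div, mul_div_assoc', ← mul_div_mul_left _ _ (two_ne_zero (α := ℂ))]
  congr 1
  ring

theorem tendsto_charFun_stdNumBlocks (t : ℝ) :
    Tendsto (fun n : ℕ => charFun ((uniformNC n).map (stdNumBlocks n)) t) atTop
      (𝓝 (charFun (gaussianReal 0 1) t)) := by
  -- As the variance is asymptotic to `n / 8`, `√n * s n` tends to `√2 * t`.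
  set s : ℕ → ℝ := fun n => t / (2 * √(variance (numBlocks n) (uniformNC n))) with hs_def
  have hs : Tendsto (fun n : ℕ => √(n : ℝ) * s n) atTop (𝓝 (t / (2 * √(1 / 8)))) := by
    have h8 : 2 * √(1 / 8 : ℝ) ≠ 0 := by positivity
    have h := (tendsto_const_nhds (x := t)).div ((tendsto_variance_div.sqrt).const_mul 2) h8
    refine h.congr' ?_
    filter_upwards [eventually_ge_atTop 1] with n hn
    have hsq : √(n : ℝ) ≠ 0 := by positivity
    rw [Pi.div_apply, Real.sqrt_div' _ n.cast_nonneg, hs_def]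
    simp only [mul_div_assoc', div_div_eq_mul_div]
    rw [mul_comm]
  have hs0 : Tendsto s atTop (𝓝 0) := by
    have h1 : Tendsto (fun n : ℕ => (√(n : ℝ))⁻¹) atTop (𝓝 0) :=
      tendsto_inv_atTop_zero.comp (Real.tendsto_sqrt_atTop.comp tendsto_natCast_atTop_atTop)
    have h2 := h1.mul hs
    rw [zero_mul] at h2
    refine h2.congr' ?_
    filter_upwards [eventually_ge_atTop 1] with n hn
    rw [inv_mul_cancel_left₀ (by positivity)]
  have hnum := tendsto_sqrt_mul_cosPowIntegral hs hs0
  have hden := tendsto_sqrt_mul_cosPowIntegral (s := fun _ => 0) (a := 0)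
    (by simp) tendsto_const_nhds
  have hne : ((Real.exp (-0 ^ 2 / 4) * √(4 * Real.pi) : ℝ) : ℂ) ≠ 0 := by
    rw [Complex.ofReal_ne_zero]
    positivity
  have h := hnum.div hden hne
  have hlim : ((Real.exp (-(t / (2 * √(1 / 8))) ^ 2 / 4) * √(4 * Real.pi) : ℝ) : ℂ) /
      ((Real.exp (-0 ^ 2 / 4) * √(4 * Real.pi) : ℝ) : ℂ) = charFun (gaussianReal 0 1) t := by
    have hpi : √(4 * Real.pi) ≠ 0 := by positivity
    rw [← Complex.ofReal_div, mul_div_mul_right _ _ hpi, charFun_gaussianReal, div_pow, mul_pow,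
      Real.sq_sqrt (by norm_num)]
    push_cast
    norm_num
    ring_nf
  rw [hlim] at h
  refine h.congr' ?_
  filter_upwards [eventually_ge_atTop 1] with n hn
  have hsq : ((√(n : ℝ) : ℝ) : ℂ) ≠ 0 := by
    rw [Complex.ofReal_ne_zero]
    positivity
  rw [charFun_stdNumBlocks hn, Pi.div_apply, mul_div_mul_left _ _ hsq]

/-- Lévy's continuity theorem together with the portmanteau theorem, for an atomless limit. -/
theorem tendsto_cdf_of_tendsto_charFun {μ : ℕ → Measure ℝ} [∀ n, IsProbabilityMeasure (μ n)]
    {ν : Measure ℝ} [IsProbabilityMeasure ν] [NullSingletonClass ν]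
    (h : ∀ t, Tendsto (fun n => charFun (μ n) t) atTop (𝓝 (charFun ν t))) (x : ℝ) :
    Tendsto (fun n => cdf (μ n) x) atTop (𝓝 (cdf ν x)) := by
  have hlim : Tendsto (β := ProbabilityMeasure ℝ) (fun n => ⟨μ n, inferInstance⟩) atTop
      (𝓝 ⟨ν, inferInstance⟩) := ProbabilityMeasure.tendsto_of_tendsto_charFun h
  have h' := ProbabilityMeasure.tendsto_measure_of_null_frontier_of_tendsto' hlim
    (E := Set.Iic x) (by rw [frontier_Iic]; exact measure_singleton (μ := ν) x)
  simp only [cdf_eq_real, measureReal_def]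
  exact (ENNReal.tendsto_toReal (measure_ne_top ν _)).comp h'

theorem mainTheorem6 :
    (∀ n : ℕ, 1 ≤ n →
      ∫ P, numBlocks n P ∂(uniformNC n) = ((n : ℝ) + 1) / 2 ∧
      variance (numBlocks n) (uniformNC n) = ((n : ℝ) ^ 2 - 1) / (4 * (2 * (n : ℝ) - 1))) ∧
    Asymptotics.IsEquivalent atTop
      (fun n : ℕ => variance (numBlocks n) (uniformNC n)) (fun n : ℕ => (n : ℝ) / 8) ∧
    ∀ x : ℝ, Tendsto (fun n : ℕ => cdf ((uniformNC n).map (stdNumBlocks n)) x) atTop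
      (𝓝 (cdf (gaussianReal 0 1) x)) := by
  refine ⟨fun n hn => ⟨mean_numBlocks hn, variance_numBlocks hn⟩, ?_, fun x => ?_⟩
  · refine (Asymptotics.isEquivalent_iff_tendsto_one ?_).2 ?_
    · filter_upwards [eventually_ge_atTop 1] with n hn
      positivity
    · have h := tendsto_variance_div.mul_const 8
      rw [show (1 / 8 : ℝ) * 8 = 1 by norm_num] at h
      refine h.congr fun n => ?_
      rw [Pi.div_apply, div_div_eq_mul_div, div_mul_eq_mul_div]
  · have hprob : ∀ n, IsProbabilityMeasure ((uniformNC n).map (stdNumBlocks n)) := fun n =>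
      Measure.isProbabilityMeasure_map (Measurable.of_discrete).aemeasurable
    have hnull : NullSingletonClass (gaussianReal 0 1) := nullSingletonClass_gaussianReal one_ne_zero
    exact tendsto_cdf_of_tendsto_charFun tendsto_charFun_stdNumBlocks x
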